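/- Let $\mathcal H$ be a complex Hilbert space (not necessarily separable), and for a set $\mathfrak M$ of bounded operators on $\mathcal H$ let $\mathfrak M' = \{T\in\mathfrak B(\mathcal H) : TA = AT \text{ for all } A\in\mathfrak M\}$ denote its commutant and $\mathfrak M''=(\mathfrak M')'$ its double commutant. Let $\mathfrak R$ be a von Neumann algebra on $\mathcal H$, that is, a $^*$-subalgebra of $\mathfrak B(\mathcal H)$ containing the identity operator with $\mathfrak R''=\mathfrak R$, and let $\mathcal L_{\mathfrak R}(\mathcal H)=\{P\in\mathfrak R : PP=P=P^*\}$ be the lattice of orthogonal projectors in $\mathfrak R$. Then $$\mathcal L_{\mathfrak R}(\mathcal H)''=\mathfrak R .$$ Equivalently, $\mathfrak R$ is generated by its orthogonal projectors: $\mathfrak R$ is the smallest von Neumann algebra on $\mathcal H$ that contains $\mathcal L_{\mathfrak R}(\mathcal H)$. -/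

import Mathlib

/-- The orthogonal projectors of `H` (bounded operators `P` with `P P = P` and `P* = P`) that belong
to the von Neumann algebra `R`. -/
def orthogonalProjectorsIn {H : Type*} [NormedAddCommGroup H] [InnerProductSpace ℂ H]
    [CompleteSpace H] (R : VonNeumannAlgebra H) : Set (H →L[ℂ] H) :=
  {P | P ∈ R ∧ IsStarProjection P}

/-! No spectral theorem is needed. Write a self-adjoint `a` as `s * |a|` with `s = 1 - 2 * q` a
symmetry in `R`. As `|a|` lies within `‖a‖ / 2` of the scalar `‖a‖ / 2`, subtracting `(‖a‖ / 2) • s`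
halves the norm. If `t` commutes with all projectors, this leaves the commutator with `t` unchanged,
so iterating forces it to vanish; real and imaginary parts give all of `R`. -/

/-- For a self-adjoint operator `a`, the orthogonal projection `q` onto the kernel of the positive
part of `a` lies in every von Neumann algebra that contains `a`, and subtracting `‖a‖ / 2` times
the symmetry `1 - 2 q` from `a` halves the bound on its norm. -/
theorem IsSelfAdjoint.exists_isStarProjection_norm_sub_le {H : Type*} [NormedAddCommGroup H]
    [InnerProductSpace ℂ H] [CompleteSpace H] (R : VonNeumannAlgebra H) {a : H →L[ℂ] H}
    (ha : IsSelfAdjoint a) (haR : a ∈ R) :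
    ∃ q ∈ R, IsStarProjection q ∧ ‖a - (‖a‖ / 2) • (1 - 2 * q)‖ ≤ ‖a‖ / 2 := by
  set p : H →L[ℂ] H := cfc (fun x : ℝ ↦ max x 0) a with hp
  set n : H →L[ℂ] H := cfc (fun x : ℝ ↦ max (-x) 0) a with hn
  have hpn : p * n = 0 := by
    rw [hp, hn, ← cfc_mul (fun x : ℝ ↦ max x 0) (fun x : ℝ ↦ max (-x) 0) a, ← cfc_zero ℝ a]
    refine cfc_congr fun x _ ↦ ?_
    rcases le_total 0 x with h | h <;> simp [h]
  have hsub : p - n = a := by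
    rw [hp, hn, ← cfc_sub (fun x : ℝ ↦ max x 0) (fun x : ℝ ↦ max (-x) 0) a]
    conv_rhs => rw [← cfc_id ℝ a]
    refine cfc_congr fun x _ ↦ ?_
    rcases le_total 0 x with h | h <;> simp [h]
  -- Here `p + n` is `|a|`, and `|x|` lies in `[0, ‖a‖]` on the spectrum, an interval centred at
  -- `‖a‖ / 2`.
  have hsum : ‖p + n - algebraMap ℝ (H →L[ℂ] H) (‖a‖ / 2)‖ ≤ ‖a‖ / 2 := by
    rw [hp, hn, ← cfc_add a (fun x : ℝ ↦ max x 0) (fun x : ℝ ↦ max (-x) 0),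
      ← cfc_const (‖a‖ / 2) a, ← cfc_sub _ _ a]
    refine norm_cfc_le (by positivity) fun x hx ↦ ?_
    have hxa : ‖x‖ ≤ ‖a‖ := by
      simpa [cfc_id' ℝ a] using norm_apply_le_norm_cfc (fun x : ℝ ↦ x) a hx
    rw [Real.norm_eq_abs, abs_le] at hxa ⊢
    rcases le_total 0 x with h | h <;> simp only [h, max_eq_left, max_eq_right, Left.neg_nonpos_iff,
      Left.nonneg_neg_iff] <;> constructor <;> linarith
  have hps : star p = p := (cfc_predicate (fun x : ℝ ↦ max x 0) a : IsSelfAdjoint p)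
  have : CompleteSpace p.ker := p.isClosed_ker.completeSpace_coe
  set q : H →L[ℂ] H := p.ker.starProjection with hq
  have hqP : IsStarProjection q := isStarProjection_starProjection
  have hqs : star q = q := hqP.isSelfAdjoint
  have hqq : q * q = q := hqP.isIdempotentElem
  have hpq : p * q = 0 := by
    ext x
    exact LinearMap.mem_ker.mp (Submodule.starProjection_apply_mem p.ker x)
  have hqp : q * p = 0 := by simpa [hps, hqs] using congrArg star hpq
  have hqn : q * n = n := by
    ext x
    exact Submodule.starProjection_eq_self_iff.mpr
      (LinearMap.mem_ker.mpr (DFunLike.congr_fun hpn x))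
  refine ⟨q, (VonNeumannAlgebra.IsStarProjection.mem_iff hqP R).mpr ?_, hqP, ?_⟩
  -- Each `y` in the commutant commutes with `p`, hence preserves `p.ker`; this puts `q` in `R''`.
  · intro y hy
    rw [hq, Submodule.range_starProjection, Module.End.mem_invtSubmodule]
    intro x hx
    have hpy : p * y = y * p :=
      Commute.cfc_real (VonNeumannAlgebra.mem_commutant_iff.mp hy a haR) _
    have hx' : p x = 0 := hx
    have := DFunLike.congr_fun hpy x
    simpa [hx'] using this
  · set s : H →L[ℂ] H := 1 - 2 * q with hs
    have hss : star s * s = 1 := by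
      have h : star s = s := by simp [hs, hqs, two_mul]
      rw [h, hs]
      calc (1 - 2 * q) * (1 - 2 * q) = 1 - 4 * q + 4 * (q * q) := by noncomm_ring
        _ = 1 := by rw [hqq]; noncomm_ring
    have hsn : ‖s‖ ≤ 1 := by
      have h1 : ‖s‖ * ‖s‖ ≤ 1 := by
        rw [← CStarRing.norm_star_mul_self, hss]
        exact ContinuousLinearMap.norm_id_le
      nlinarith [norm_nonneg s]
    -- `s` fixes `p` and negates `n`, so `s * (p + n) = a`.
    have key : a - (‖a‖ / 2) • s = s * (p + n - algebraMap ℝ (H →L[ℂ] H) (‖a‖ / 2)) := by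
      rw [mul_sub, ← Algebra.commutes, ← Algebra.smul_def]
      congr 1
      calc a = p - n := hsub.symm
        _ = p + n - 2 * (q * p) - 2 * (q * n) := by rw [hqp, hqn]; noncomm_ring
        _ = s * (p + n) := by rw [hs]; noncomm_ring
    rw [key]
    calc _ ≤ ‖s‖ * ‖p + n - algebraMap ℝ (H →L[ℂ] H) (‖a‖ / 2)‖ := norm_mul_le _ _
      _ ≤ 1 * (‖a‖ / 2) := by gcongr
      _ = ‖a‖ / 2 := one_mul _

/-- An operator that commutes with every orthogonal projection of a von Neumann algebra commutes
with every self-adjoint element of it. -/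
theorem IsSelfAdjoint.commute_of_mem_centralizer_orthogonalProjectorsIn {H : Type*}
    [NormedAddCommGroup H] [InnerProductSpace ℂ H] [CompleteSpace H] {R : VonNeumannAlgebra H}
    {t a : H →L[ℂ] H} (ht : t ∈ Set.centralizer (orthogonalProjectorsIn R))
    (ha : IsSelfAdjoint a) (haR : a ∈ R) : a * t = t * a := by
  -- Quantified over all `b`, since the induction passes from `b` to `b - c`.
  have bound : ∀ k : ℕ, ∀ b ∈ R, IsSelfAdjoint b →
      ‖b * t - t * b‖ ≤ (2 * ‖t‖ * ‖b‖) * (1 / 2) ^ k := by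
    intro k
    induction k with
    | zero =>
      intro b _ _
      calc ‖b * t - t * b‖ ≤ ‖b‖ * ‖t‖ + ‖t‖ * ‖b‖ :=
            (norm_sub_le _ _).trans (add_le_add (norm_mul_le _ _) (norm_mul_le _ _))
        _ = _ := by ring
    | succ k ih =>
      intro b hbR hb
      obtain ⟨q, hqR, hq, hle⟩ := hb.exists_isStarProjection_norm_sub_le R hbR
      have hqt : q * t = t * q := ht q ⟨hqR, hq⟩
      set c : H →L[ℂ] H := (‖b‖ / 2) • (1 - 2 * q) with hc
      have hct : c * t = t * c := by
        have h : (1 - 2 * q) * t = t * (1 - 2 * q) := by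
          calc (1 - 2 * q) * t = t - 2 * (q * t) := by noncomm_ring
            _ = t * (1 - 2 * q) := by rw [hqt]; noncomm_ring
        rw [hc, smul_mul_assoc, mul_smul_comm, h]
      have hcs : IsSelfAdjoint c := by
        refine IsSelfAdjoint.smul (.all _) ?_
        simp [isSelfAdjoint_iff, two_mul, hq.isSelfAdjoint.star_eq]
      have hcR : c ∈ R := by
        have h : (1 - 2 * q) ∈ R.toStarSubalgebra := by
          rw [two_mul]
          exact sub_mem (one_mem _) (add_mem hqR hqR)
        exact R.toStarSubalgebra.smul_mem h ((‖b‖ / 2 : ℝ) : ℂ)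
      have h := ih (b - c) (sub_mem hbR hcR) (hb.sub hcs)
      have heq : (b - c) * t - t * (b - c) = b * t - t * b := by
        rw [sub_mul, mul_sub, hct]; abel
      rw [heq] at h
      calc ‖b * t - t * b‖ ≤ (2 * ‖t‖ * ‖b - c‖) * (1 / 2) ^ k := h
        _ ≤ (2 * ‖t‖ * (‖b‖ / 2)) * (1 / 2) ^ k := by gcongr
        _ = _ := by rw [pow_succ]; ring
  have hlim : Filter.Tendsto (fun k : ℕ ↦ (2 * ‖t‖ * ‖a‖) * (1 / 2 : ℝ) ^ k) Filter.atTop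
      (nhds 0) := by
    simpa using (tendsto_pow_atTop_nhds_zero_of_lt_one (r := (1 / 2 : ℝ)) (by norm_num)
      (by norm_num)).const_mul (2 * ‖t‖ * ‖a‖)
  have hz : ‖a * t - t * a‖ ≤ 0 := ge_of_tendsto' hlim fun k ↦ bound k a haR ha
  exact sub_eq_zero.mp (norm_le_zero_iff.mp hz)

open scoped ComplexStarModule in
/-- A von Neumann algebra is contained in the double commutant of its orthogonal projections. -/
theorem subset_centralizer_centralizer_orthogonalProjectorsIn {H : Type*} [NormedAddCommGroup H]
    [InnerProductSpace ℂ H] [CompleteSpace H] (R : VonNeumannAlgebra H) :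
    (R : Set (H →L[ℂ] H)) ⊆ Set.centralizer (Set.centralizer (orthogonalProjectorsIn R)) := by
  intro a haR t ht
  have haS : a ∈ R.toStarSubalgebra := haR
  have hre : (ℜ a : H →L[ℂ] H) ∈ R.toStarSubalgebra := by
    rw [realPart_apply_coe]
    exact R.toStarSubalgebra.smul_mem (add_mem haS (star_mem haS)) ((2⁻¹ : ℝ) : ℂ)
  have him : (ℑ a : H →L[ℂ] H) ∈ R.toStarSubalgebra := by
    rw [imaginaryPart_apply_coe]
    exact R.toStarSubalgebra.smul_mem
      (R.toStarSubalgebra.smul_mem (sub_mem haS (star_mem haS)) ((2⁻¹ : ℝ) : ℂ)) _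
  have h1 := (ℜ a).2.commute_of_mem_centralizer_orthogonalProjectorsIn ht hre
  have h2 := (ℑ a).2.commute_of_mem_centralizer_orthogonalProjectorsIn ht him
  rw [← realPart_add_I_smul_imaginaryPart a, mul_add, add_mul, h1, mul_smul_comm, smul_mul_assoc,
    h2]

theorem mainTheorem6 {H : Type*} [NormedAddCommGroup H] [InnerProductSpace ℂ H] [CompleteSpace H]
    (R : VonNeumannAlgebra H) :
    Set.centralizer (Set.centralizer (orthogonalProjectorsIn R)) = (R : Set (H →L[ℂ] H)) ∧
      IsLeast {S : VonNeumannAlgebra H | orthogonalProjectorsIn R ⊆ (S : Set (H →L[ℂ] H))} R := by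
  have hsub : orthogonalProjectorsIn R ⊆ (R : Set (H →L[ℂ] H)) := fun _ h ↦ h.1
  have mono : ∀ S : VonNeumannAlgebra H, orthogonalProjectorsIn R ⊆ (S : Set (H →L[ℂ] H)) →
      Set.centralizer (Set.centralizer (orthogonalProjectorsIn R)) ⊆ (S : Set (H →L[ℂ] H)) := by
    intro S hS
    rw [← S.centralizer_centralizer]
    exact Set.centralizer_subset (Set.centralizer_subset hS)
  have hR := subset_centralizer_centralizer_orthogonalProjectorsIn R
  exact ⟨(mono R hsub).antisymm hR, hsub, fun S hS ↦ hR.trans (mono S hS)⟩
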